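/- Let $\mathfrak{D}_n$ be the set of derangements of $[n]=\{1,\dots,n\}$ (permutations without fixed points; $\mathfrak{D}_0$ consists of the empty permutation). For a permutation $\pi$ of $[n]$, let $\operatorname{cddes}(\pi)$ be the number of its cyclic double descents, i.e. of letters $\pi_i$ with $i>\pi_i>\pi_{\pi_i}$. Put $$D_n^{\operatorname{cddes}}(t)=\sum_{\pi\in\mathfrak{D}_n}t^{\operatorname{cddes}(\pi)}\in\mathbb{Z}[t],\qquad D^{\operatorname{cddes}}(t;x)=1+\sum_{n\ge1}D_n^{\operatorname{cddes}}(t)\frac{x^n}{n!}.$$ Define the bivariate Chebyshev polynomials of the second kind by $U_0(s,t)=1$, $U_1(s,t)=2t$ and $U_n(s,t)=2t\,U_{n-1}(s,t)-s\,U_{n-2}(s,t)$ for $n\ge2$, and put $$V(s,t;x)=\sum_{n\ge0}U_n(s,t)\frac{x^{n+2}}{(n+2)!}.$$ Let the Euler numbers $E_n$ be defined by $\sum_{n\ge0}E_n\frac{x^n}{n!}=\sec x+\tan x$. Then the following identities of formal power series in $x$, respectively of numbers, hold. 1. $\displaystyle D^{\operatorname{cddes}}(t;x)=\frac{1}{1-V\left(1,\frac{1+t}{2};x\right)}$,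 where $t$ is an indeterminate or, more generally, any element of any commutative $\mathbb{Q}$-algebra. 2. For all $n\ge1$, $D_n^{\operatorname{cddes}}(-1)=E_n$ if $n$ is even, and $D_n^{\operatorname{cddes}}(-1)=0$ if $n$ is odd. 3. $D^{\operatorname{cddes}}(-1;x)=\sec x$. -/

import Mathlib

open PowerSeries
open scoped Nat

namespace DerangementCddes

/-- The number of cyclic double descents of a permutation `π` of an `n`-element chain: the number of
letters `π i` with `i > π i > π (π i)`, counted through their positions `i`. -/
def cddes {n : ℕ} (π : Equiv.Perm (Fin n)) : ℕ :=
  (Finset.univ.filter fun i : Fin n => π i < i ∧ π (π i) < π i).card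

/-- The polynomial `D_n(t) = ∑ t ^ cddes π`, summed over all derangements `π` of `n` letters. -/
noncomputable def cddesPoly (n : ℕ) : Polynomial ℤ :=
  ∑ π : derangements (Fin n), Polynomial.X ^ cddes (π : Equiv.Perm (Fin n))

/-- The empty permutation is a derangement, so the constant term of the generating function below
is `1`. -/
theorem cddesPoly_zero : cddesPoly 0 = 1 := by
  have h : Fintype.card (derangements (Fin 0)) = 1 := by decide
  simp [cddesPoly, cddes, h]

/-- The bivariate Chebyshev polynomials of the second kind `U_n(s, t)`. -/
def chebyU {R : Type*} [CommRing R] (s t : R) : ℕ → R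
  | 0 => 1
  | 1 => 2 * t
  | n + 2 => 2 * t * chebyU s t (n + 1) - s * chebyU s t n

/-- The formal power series `V(s, t; x) = ∑_{n ≥ 0} U_n(s, t) x ^ (n + 2) / (n + 2)!`. -/
noncomputable def chebyV {R : Type*} [CommRing R] [Algebra ℚ R] (s t : R) : R⟦X⟧ :=
  PowerSeries.mk fun m =>
    match m with
    | 0 => 0
    | 1 => 0
    | n + 2 => (1 / ((n + 2)! : ℚ)) • chebyU s t n

/-- The exponential generating function `D(t; x) = ∑_{n ≥ 0} D_n(t) x ^ n / n!`, as a formal power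
series in `x`. -/
noncomputable def cddesEGF {R : Type*} [CommRing R] [Algebra ℚ R] (t : R) : R⟦X⟧ :=
  PowerSeries.mk fun n => (1 / (n ! : ℚ)) • Polynomial.aeval t (cddesPoly n)

/-- The Taylor series of `sec x` at `0`, the formal reciprocal of that of `cos x` (whose constant
term is `1`). -/
noncomputable def secSeries : ℚ⟦X⟧ := (PowerSeries.cos ℚ)⁻¹

/-- The Taylor series of `tan x` at `0`. -/
noncomputable def tanSeries : ℚ⟦X⟧ := PowerSeries.sin ℚ * (PowerSeries.cos ℚ)⁻¹

/-- The Euler number `E_n`, given by `∑ E_n x ^ n / n! = sec x + tan x`. -/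
noncomputable def eulerNumber (n : ℕ) : ℚ :=
  (n ! : ℚ) * PowerSeries.coeff n (secSeries + tanSeries)

end DerangementCddes

/-! Weight each letter of a permutation by its cyclic type. A new least letter is either a fixed
point or splits an arc `a → τ a`; it is then a valley and changes the type only of the lower end of
the arc. Summed over the arcs, this acts on weights as a derivation with `e, u, t ↦ q` and `q ↦
q(t+u)` (`sum_permWeight_succ`). With `W = 1 - V`, `Z = 1/W` and `E = Z'/Z`, the series `E, 1+E,
t+E, E'` obey these rules under `d/dx`, so the `n`-th derivative of `Z` is `Z` times the total
weight over permutations of `n` letters. At `x = 0` the weights become `0, 1, t, 1`, which leaves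
`D_n(t)`. For `t = -1`, `W` is the cosine series. -/

namespace DerangementCddes

/-! ### Insertion of a least letter as a derivation -/

section Weight

variable {A : Type*} [CommRing A]

/-- The weight of a letter `y` with cyclic predecessor `x` and cyclic successor `z`: `e` for a fixed
point, `u` for a double ascent, `t` for a double descent, `q` for a valley and `1` for a peak. -/
def letterWeight {α : Type*} [LinearOrder α] (e u t q : A) (x y z : α) : A :=
  if y = z then e else if x < y then (if y < z then u else 1) else (if y < z then q else t)

/-- The product of the weights of all letters of a permutation. -/
def permWeight {n : ℕ} (e u t q : A) (π : Equiv.Perm (Fin n)) : A :=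
  ∏ j, letterWeight e u t q (π.symm j) j (π j)

variable {n : ℕ} (τ : Equiv.Perm (Fin n)) (a : Fin n)

/-- Insert a new least letter as a fixed point. -/
def insertFixed : Equiv.Perm (Fin (n + 1)) := Equiv.Perm.decomposeFin.symm (0, τ)

/-- Insert a new least letter between `a` and `τ a`. -/
def insertAfter : Equiv.Perm (Fin (n + 1)) := Equiv.Perm.decomposeFin.symm ((τ a).succ, τ)

theorem insertFixed_zero : insertFixed τ 0 = 0 := by simp [insertFixed]

theorem insertFixed_succ (k : Fin n) : insertFixed τ k.succ = (τ k).succ := by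
  simp [insertFixed]

theorem insertFixed_symm_succ (k : Fin n) : (insertFixed τ).symm k.succ = (τ.symm k).succ := by
  rw [Equiv.symm_apply_eq, insertFixed_succ]; simp

theorem insertAfter_zero : insertAfter τ a 0 = (τ a).succ := by simp [insertAfter]

theorem insertAfter_succ (k : Fin n) :
    insertAfter τ a k.succ = if k = a then 0 else (τ k).succ := by
  split_ifs with h
  · simp [insertAfter, h]
  · simp [insertAfter, Equiv.swap_apply_def, h]

theorem insertAfter_symm_zero : (insertAfter τ a).symm 0 = a.succ := by
  rw [Equiv.symm_apply_eq, insertAfter_succ, if_pos rfl]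

theorem insertAfter_symm_succ (k : Fin n) :
    (insertAfter τ a).symm k.succ = if k = τ a then 0 else (τ.symm k).succ := by
  rw [Equiv.symm_apply_eq]
  split_ifs with h
  · rw [insertAfter_zero, h]
  · rw [insertAfter_succ, if_neg]
    · simp
    · rintro rfl
      simp at h

theorem permWeight_insertFixed (e u t q : A) :
    permWeight e u t q (insertFixed τ) = e * permWeight e u t q τ := by
  unfold permWeight
  rw [Fin.prod_univ_succ]
  simp [insertFixed_zero, insertFixed_succ, insertFixed_symm_succ, letterWeight]

/-- Only `a` changes type: a fixed point or double ascent becomes a peak, a valley becomes a double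
descent. The factor `q` is the new letter. -/
theorem permWeight_insertAfter_of_le (e u t q : A) (h : a ≤ τ a) :
    permWeight e u t q (insertAfter τ a) =
      (∏ k ∈ Finset.univ.erase a, letterWeight e u t q (τ.symm k) k (τ k)) *
        (if τ.symm a ≤ a then q else q * t) := by
  unfold permWeight
  rw [Fin.prod_univ_succ, ← Finset.mul_prod_erase Finset.univ _ (Finset.mem_univ a)]
  have h0 : letterWeight e u t q ((insertAfter τ a).symm 0) 0 (insertAfter τ a 0) = q := by
    simp [insertAfter_zero, insertAfter_symm_zero, letterWeight, (Fin.succ_ne_zero _).symm]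
  have hp : ∀ k ∈ Finset.univ.erase a,
      letterWeight e u t q ((insertAfter τ a).symm k.succ) k.succ (insertAfter τ a k.succ) =
        letterWeight e u t q (τ.symm k) k (τ k) := by
    intro k hk
    have hka := Finset.ne_of_mem_erase hk
    rw [insertAfter_succ, insertAfter_symm_succ, if_neg hka]
    split_ifs with hb
    · subst hb
      have : a < τ a := lt_of_le_of_ne h hka.symm
      simp [letterWeight, this]
    · simp [letterWeight]
  have hc : letterWeight e u t q ((insertAfter τ a).symm a.succ) a.succ (insertAfter τ a a.succ) =
      if τ.symm a ≤ a then 1 else t := by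
    rw [insertAfter_succ, insertAfter_symm_succ, if_pos rfl]
    have hfix : τ.symm a = a ↔ a = τ a := by rw [Equiv.symm_apply_eq]
    by_cases hb : a = τ a
    · rw [if_pos hb, if_pos (hfix.2 hb).le]
      simp [letterWeight, Fin.succ_ne_zero]
    · have : τ.symm a ≤ a ↔ τ.symm a < a :=
        ⟨fun h => lt_of_le_of_ne h fun h => hb (hfix.1 h), le_of_lt⟩
      simp [letterWeight, Fin.succ_ne_zero, hb, this]
  rw [h0, hc, Finset.prod_congr rfl hp]
  split_ifs <;> ring

/-- Here only `τ a` changes: a double descent becomes a peak, a valley a double ascent. -/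
theorem permWeight_insertAfter_of_lt (e u t q : A) (h : τ a < a) :
    permWeight e u t q (insertAfter τ a) =
      (∏ k ∈ Finset.univ.erase (τ a), letterWeight e u t q (τ.symm k) k (τ k)) *
        (if τ a < τ (τ a) then q * u else q) := by
  unfold permWeight
  rw [Fin.prod_univ_succ, ← Finset.mul_prod_erase Finset.univ _ (Finset.mem_univ (τ a))]
  have h0 : letterWeight e u t q ((insertAfter τ a).symm 0) 0 (insertAfter τ a 0) = q := by
    simp [insertAfter_zero, insertAfter_symm_zero, letterWeight, (Fin.succ_ne_zero _).symm]
  have hp : ∀ k ∈ Finset.univ.erase (τ a),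
      letterWeight e u t q ((insertAfter τ a).symm k.succ) k.succ (insertAfter τ a k.succ) =
        letterWeight e u t q (τ.symm k) k (τ k) := by
    intro k hk
    have hka := Finset.ne_of_mem_erase hk
    rw [insertAfter_succ, insertAfter_symm_succ, if_neg hka]
    split_ifs with hb
    · subst hb
      simp [letterWeight, Fin.succ_ne_zero, h.ne', h.not_gt]
    · simp [letterWeight]
  have hc : letterWeight e u t q ((insertAfter τ a).symm (τ a).succ) (τ a).succ
      (insertAfter τ a (τ a).succ) = if τ a < τ (τ a) then u else 1 := by
    rw [insertAfter_succ, insertAfter_symm_succ, if_pos rfl, if_neg h.ne]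
    have : τ a ≠ τ (τ a) := fun h' => h.ne (τ.injective h').symm
    simp [letterWeight, this]
  rw [h0, hc, Finset.prod_congr rfl hp]
  split_ifs <;> ring

theorem derivation_prod {S ι : Type*} [CommRing S] [Algebra S A] [DecidableEq ι]
    (d : Derivation S A A) (s : Finset ι) (f : ι → A) :
    d (∏ i ∈ s, f i) = ∑ i ∈ s, (∏ j ∈ s.erase i, f j) * d (f i) := by
  induction s using Finset.induction_on with
  | empty => simp
  | insert a s ha ih =>
    rw [Finset.prod_insert ha, Derivation.leibniz, ih, Finset.sum_insert ha,
      Finset.erase_insert ha, smul_eq_mul, smul_eq_mul, Finset.mul_sum, add_comm]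
    congr 1
    refine Finset.sum_congr rfl fun i hi => ?_
    have hia : a ≠ i := fun h => ha (h ▸ hi)
    rw [Finset.erase_insert_of_ne hia, Finset.prod_insert (fun h => ha (Finset.mem_of_mem_erase h)),
      mul_assoc]

theorem sum_permWeight_insertAfter {S : Type*} [CommRing S] [Algebra S A] (d : Derivation S A A)
    {e u t q : A} (he : d e = q) (hu : d u = q) (ht : d t = q) (hq : d q = q * (t + u)) :
    ∑ a, permWeight e u t q (insertAfter τ a) = d (permWeight e u t q τ) := by
  set P : Fin n → A := fun j =>
    ∏ k ∈ Finset.univ.erase j, letterWeight e u t q (τ.symm k) k (τ k) with hP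
  have hsplit : ∀ a, permWeight e u t q (insertAfter τ a) =
      (if a ≤ τ a then P a * (if τ.symm a ≤ a then q else q * t) else 0) +
      (if τ a < τ.symm (τ a) then P (τ a) * (if τ a < τ (τ a) then q * u else q) else 0) := by
    intro a
    rw [Equiv.symm_apply_apply]
    rcases le_or_gt a (τ a) with h | h
    · rw [permWeight_insertAfter_of_le τ a e u t q h, if_pos h, if_neg h.not_gt, add_zero]
    · rw [permWeight_insertAfter_of_lt τ a e u t q h, if_pos h, if_neg h.not_ge, zero_add]
  -- Charge each arc to its lower end. A valley is charged by both its arcs, giving `q * t + q * u`;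
  -- a peak by none, matching `d 1 = 0`.
  rw [Finset.sum_congr rfl fun a _ => hsplit a, Finset.sum_add_distrib,
    Equiv.sum_comp τ fun b => if b < τ.symm b then P b * (if b < τ b then q * u else q) else 0,
    ← Finset.sum_add_distrib]
  unfold permWeight
  rw [derivation_prod]
  refine Finset.sum_congr rfl fun j _ => ?_
  have hfix : τ.symm j = j ↔ j = τ j := by rw [Equiv.symm_apply_eq]
  change _ = P j * _
  unfold letterWeight
  rcases lt_trichotomy j (τ j) with h | h | h
  · rcases lt_trichotomy (τ.symm j) j with h' | h' | h'
    · simp [h, h.le, h.ne, h', h'.le, h'.not_gt, hu]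
    · exact absurd (hfix.1 h') h.ne
    · simp [h, h.le, h.ne, h', h'.not_ge, h'.not_gt, hq]
      ring
  · have h' := hfix.2 h
    simp [← h, h', he]
  · rcases lt_trichotomy (τ.symm j) j with h' | h' | h'
    · simp [h.not_gt, h.not_ge, h.ne', h', h'.not_gt]
    · exact absurd (hfix.1 h') h.ne'
    · simp [h.not_gt, h.not_ge, h.ne', h', h'.not_gt, ht]

theorem sum_permWeight_succ {S : Type*} [CommRing S] [Algebra S A] (d : Derivation S A A)
    {e u t q : A} (he : d e = q) (hu : d u = q) (ht : d t = q) (hq : d q = q * (t + u)) (n : ℕ) :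
    ∑ π : Equiv.Perm (Fin (n + 1)), permWeight e u t q π =
      d (∑ π : Equiv.Perm (Fin n), permWeight e u t q π) +
        e * ∑ π : Equiv.Perm (Fin n), permWeight e u t q π := by
  rw [← Equiv.sum_comp Equiv.Perm.decomposeFin.symm, Fintype.sum_prod_type_right, map_sum,
    Finset.mul_sum, ← Finset.sum_add_distrib]
  refine Finset.sum_congr rfl fun τ _ => ?_
  rw [Fin.sum_univ_succ, ← sum_permWeight_insertAfter τ d he hu ht hq, ← permWeight_insertFixed,
    add_comm, ← Equiv.sum_comp τ]
  rfl

theorem map_permWeight {B : Type*} [CommRing B] (f : A →+* B) (e u t q : A) :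
    f (permWeight e u t q τ) = permWeight (f e) (f u) (f t) (f q) τ := by
  simp only [permWeight, letterWeight, map_prod, apply_ite f, map_one]

theorem permWeight_eq_zero (u t q : A) (h : τ ∉ derangements (Fin n)) :
    permWeight 0 u t q τ = 0 := by
  obtain ⟨x, hx⟩ : ∃ x, τ x = x := by simpa [derangements] using h
  exact Finset.prod_eq_zero (Finset.mem_univ x) (by simp [letterWeight, hx])

theorem permWeight_of_mem_derangements (t : A) (h : τ ∈ derangements (Fin n)) :
    permWeight 0 1 t 1 τ = t ^ cddes τ := by
  rw [permWeight, ← Equiv.prod_comp τ, cddes, ← Finset.prod_const, Finset.prod_filter]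
  refine Finset.prod_congr rfl fun i _ => ?_
  have h1 : τ i ≠ i := h i
  have h2 : τ (τ i) ≠ τ i := h (τ i)
  rw [Equiv.symm_apply_apply]
  unfold letterWeight
  rw [if_neg h2.symm]
  rcases lt_or_gt_of_ne h1 with h1 | h1 <;> rcases lt_or_gt_of_ne h2 with h2 | h2 <;>
    simp [h1, h2, h1.not_gt, h2.not_gt]

theorem sum_permWeight_eq_aeval (n : ℕ) (t : A) :
    ∑ π : Equiv.Perm (Fin n), permWeight 0 1 t 1 π = Polynomial.aeval t (cddesPoly n) := by
  classical
  simp only [cddesPoly, map_sum, map_pow, Polynomial.aeval_X]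
  rw [← Finset.sum_subset (Finset.subset_univ
      (Finset.univ.filter fun π : Equiv.Perm (Fin n) => π ∈ derangements (Fin n)))
      fun π _ hπ => permWeight_eq_zero π 1 t 1 (by simpa using hπ),
    Finset.sum_subtype (p := fun π => π ∈ derangements (Fin n)) _ (by simp)]
  exact Finset.sum_congr rfl fun π _ => permWeight_of_mem_derangements π.1 t π.2

end Weight

/-! ### The generating function via a Riccati equation -/

section Series

variable {R : Type*} [CommRing R] [Algebra ℚ R]

theorem two_mul_half_smul (x : R) : 2 * ((1 / 2 : ℚ) • x) = x := by
  rw [two_mul, ← add_smul]; norm_num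

theorem constantCoeff_chebyV (s t : R) : constantCoeff (chebyV s t) = 0 := by
  rw [← coeff_zero_eq_constantCoeff_apply, chebyV, coeff_mk]

theorem factorial_succ_smul (n : ℕ) (x : R) :
    (1 / ((n + 1)! : ℚ)) • x * (n + 1) = (1 / (n ! : ℚ)) • x := by
  have h : ((n : R) + 1) = algebraMap ℚ R (n + 1) := by simp
  rw [h, mul_comm, ← Algebra.smul_def, smul_smul, Nat.factorial_succ]
  congr 1
  push_cast
  have : (n ! : ℚ) ≠ 0 := by positivity
  field_simp

/-- This is the Chebyshev recurrence read on coefficients; the constant `1` comes from `U_0`. -/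
theorem derivative_derivative_chebyV (t : R) :
    d⁄dX R (d⁄dX R (chebyV 1 ((1 / 2 : ℚ) • (1 + t)))) =
      C (1 + t) * d⁄dX R (chebyV 1 ((1 / 2 : ℚ) • (1 + t))) +
        (1 - chebyV 1 ((1 / 2 : ℚ) • (1 + t))) := by
  set h := (1 / 2 : ℚ) • (1 + t) with hh
  have h2 : 2 * h = 1 + t := two_mul_half_smul _
  have hdd : ∀ n, coeff n (d⁄dX R (d⁄dX R (chebyV 1 h))) =
      (1 / (n ! : ℚ)) • chebyU 1 h n := by
    intro n
    have := factorial_succ_smul (n + 1) (chebyU 1 h n)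
    push_cast at this
    rw [coeff_derivative, coeff_derivative]
    push_cast
    rw [chebyV, coeff_mk]
    simp only
    rw [this, factorial_succ_smul]
  have hd : ∀ n, coeff (n + 1) (d⁄dX R (chebyV 1 h)) =
      (1 / ((n + 1)! : ℚ)) • chebyU 1 h n := by
    intro n
    have := factorial_succ_smul (n + 1) (chebyU 1 h n)
    rw [coeff_derivative, chebyV, coeff_mk]
    simpa using this
  ext n
  rw [hdd, map_add, coeff_C_mul, map_sub]
  match n with
  | 0 => simp [chebyU, coeff_derivative, chebyV, coeff_one]
  | 1 => rw [hd]; simp [chebyU, chebyV, coeff_one, h2]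
  | n + 2 =>
    rw [hd, chebyV, coeff_mk, chebyU, h2, coeff_one]
    simp [sub_eq_add_neg]

theorem cddesEGF_mul (t : R) :
    (1 - chebyV 1 ((1 / 2 : ℚ) • (1 + t))) * cddesEGF t = 1 := by
  set W := 1 - chebyV 1 ((1 / 2 : ℚ) • (1 + t)) with hW
  have hc : constantCoeff W = 1 := by simp [hW, constantCoeff_chebyV]
  have hdd : d⁄dX R (d⁄dX R W) = C (1 + t) * d⁄dX R W - W := by
    simp only [hW, map_sub, derivative_one, derivative_derivative_chebyV, map_zero]
    ring
  have hd0 : constantCoeff (d⁄dX R W) = 0 := by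
    rw [← coeff_zero_eq_constantCoeff_apply, coeff_derivative, hW]
    simp [chebyV, coeff_one]
  have hu : IsUnit W := isUnit_iff_constantCoeff.2 (hc ▸ isUnit_one)
  obtain ⟨Z, hZ⟩ := hu.exists_right_inv
  have hZ0 : constantCoeff Z = 1 := by
    simpa [hc] using congrArg constantCoeff hZ
  -- The logarithmic derivative of `Z`; the linear equation for `W` becomes a Riccati equation for
  -- `E`.
  set E := -(d⁄dX R W * Z) with hE
  have hdZ : d⁄dX R Z = E * Z := by
    have h := congrArg (d⁄dX R) hZ
    rw [Derivation.leibniz, derivative_one, smul_eq_mul, smul_eq_mul] at h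
    linear_combination Z * h - d⁄dX R Z * hZ
  have hdE : d⁄dX R E = 1 + C (1 + t) * E + E ^ 2 := by
    rw [hE, map_neg, Derivation.leibniz, smul_eq_mul, smul_eq_mul, hdZ, hdd]
    linear_combination hZ
  have hE0 : constantCoeff E = 0 := by simp [hE, hd0]
  have hiter : ∀ n, (d⁄dX R)^[n] Z = Z * ∑ π : Equiv.Perm (Fin n),
      permWeight E (1 + E) (C t + E) (1 + C (1 + t) * E + E ^ 2) π := by
    intro n
    induction n with
    | zero => simp [permWeight]
    | succ n ih =>
      rw [Function.iterate_succ_apply', ih, sum_permWeight_succ (d⁄dX R) hdE, Derivation.leibniz,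
        smul_eq_mul, smul_eq_mul, hdZ]
      · ring
      · rw [map_add, derivative_one, hdE, zero_add]
      · rw [map_add, derivative_C, hdE, zero_add]
      · simp only [map_add, derivative_one, Derivation.leibniz, derivative_C, sq, hdE, smul_eq_mul, map_one]
        ring
  have hD : cddesEGF t = Z := by
    ext n
    -- Since `E` vanishes at `0`, fixed points get weight `0` there and only derangements survive.
    have h := congrArg constantCoeff (hiter n)
    rw [constantCoeff_iterate_derivative, map_mul, hZ0, map_sum, one_mul] at h
    simp only [map_permWeight, map_add, map_mul, map_pow, map_one, constantCoeff_C, hE0] at h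
    simp only [add_zero, mul_zero, zero_pow two_ne_zero, sum_permWeight_eq_aeval] at h
    rw [cddesEGF, coeff_mk, ← h]
    have hn : ((n ! : ℕ) : R) = algebraMap ℚ R (n ! : ℚ) := by simp
    have : (n ! : ℚ) ≠ 0 := by positivity
    rw [hn, ← Algebra.smul_def, smul_smul, one_div, inv_mul_cancel₀ this, one_smul]
  rw [hD, hZ]

end Series

/-! ### The case `t = -1`: secant, and parity of the coefficients -/

theorem one_sub_chebyV_neg_one :
    1 - chebyV 1 ((1 / 2 : ℚ) • (1 + (-1 : ℚ))) = PowerSeries.cos ℚ := by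
  have hU : ∀ k, chebyU (1 : ℚ) 0 (2 * k) = (-1) ^ k ∧ chebyU (1 : ℚ) 0 (2 * k + 1) = 0 := by
    intro k
    induction k with
    | zero => simp [chebyU]
    | succ k ih =>
      rw [show 2 * (k + 1) = 2 * k + 2 by ring, show 2 * k + 2 + 1 = (2 * k + 1) + 2 by ring,
        chebyU, chebyU, ih.1, ih.2]
      simp [pow_succ]
  rw [add_neg_cancel, smul_zero]
  ext n
  rw [map_sub, PowerSeries.cos, coeff_mk, chebyV, coeff_mk, coeff_one]
  match n with
  | 0 => simp
  | 1 => simp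
  | n + 2 =>
    obtain ⟨k, rfl | rfl⟩ := Nat.even_or_odd' n
    · have h : (2 * k + 2) / 2 = k + 1 := by lia
      simp only
      rw [(hU k).1, if_pos (show Even (2 * k + 2) from ⟨k + 1, by ring⟩), h]
      simp [pow_succ, div_eq_inv_mul]
    · simp [(hU k).2, Nat.even_add_one]

theorem cddesEGF_neg_one : cddesEGF (-1 : ℚ) = secSeries := by
  have h := cddesEGF_mul (-1 : ℚ)
  rw [one_sub_chebyV_neg_one] at h
  have hc : constantCoeff (PowerSeries.cos ℚ) ≠ 0 := by
    rw [← coeff_zero_eq_constantCoeff_apply]; simp [PowerSeries.cos]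
  rw [secSeries, PowerSeries.eq_inv_iff_mul_eq_one hc, mul_comm, h]

theorem evalNegHom_cos : evalNegHom (PowerSeries.cos ℚ) = PowerSeries.cos ℚ := by
  ext n
  rw [evalNegHom, coeff_rescale, PowerSeries.cos, coeff_mk]
  split_ifs with h
  · rw [h.neg_one_pow, one_mul]
  · rw [mul_zero]

theorem evalNegHom_sin : evalNegHom (PowerSeries.sin ℚ) = -PowerSeries.sin ℚ := by
  ext n
  rw [evalNegHom, coeff_rescale, map_neg, PowerSeries.sin, coeff_mk]
  split_ifs with h
  · simp
  · rw [(Nat.not_even_iff_odd.1 h).neg_one_pow, neg_one_mul]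

theorem evalNegHom_secSeries : evalNegHom secSeries = secSeries := by
  have hc : constantCoeff (PowerSeries.cos ℚ) ≠ 0 := by
    rw [← coeff_zero_eq_constantCoeff_apply]; simp [PowerSeries.cos]
  have h := congrArg evalNegHom (PowerSeries.inv_mul_cancel _ hc)
  rw [map_mul, evalNegHom_cos, map_one] at h
  exact (PowerSeries.eq_inv_iff_mul_eq_one hc).2 h

theorem coeff_secSeries_of_odd {n : ℕ} (h : Odd n) : coeff n secSeries = 0 := by
  have := congrArg (coeff n) evalNegHom_secSeries
  rw [evalNegHom, coeff_rescale, h.neg_one_pow] at this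
  linarith

theorem coeff_tanSeries_of_even {n : ℕ} (h : Even n) : coeff n tanSeries = 0 := by
  have hs : evalNegHom tanSeries = -tanSeries := by
    rw [tanSeries, map_mul, evalNegHom_sin, ← secSeries, evalNegHom_secSeries, neg_mul]
  have := congrArg (coeff n) hs
  rw [evalNegHom, coeff_rescale, h.neg_one_pow, map_neg] at this
  linarith

theorem eval_neg_one_cddesPoly (n : ℕ) :
    (((cddesPoly n).eval (-1) : ℤ) : ℚ) = n ! * coeff n secSeries := by
  have hn : (n ! : ℚ) ≠ 0 := by positivity
  have h : Polynomial.aeval (-1 : ℚ) (cddesPoly n) = (((cddesPoly n).eval (-1) : ℤ) : ℚ) := by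
    have := Polynomial.aeval_algebraMap_apply_eq_algebraMap_eval (A := ℚ) (-1 : ℤ) (cddesPoly n)
    simpa using this
  rw [← cddesEGF_neg_one, cddesEGF, coeff_mk, h, smul_eq_mul]
  field_simp

end DerangementCddes

theorem mainTheorem10 :
    (∀ (R : Type*) [CommRing R] [Algebra ℚ R] (t : R),
      IsUnit (1 - DerangementCddes.chebyV 1 ((1 / 2 : ℚ) • (1 + t))) ∧
        DerangementCddes.cddesEGF t =
          Ring.inverse (1 - DerangementCddes.chebyV 1 ((1 / 2 : ℚ) • (1 + t)))) ∧
    (∀ n : ℕ, 1 ≤ n →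
      (((DerangementCddes.cddesPoly n).eval (-1) : ℤ) : ℚ) =
        if Even n then DerangementCddes.eulerNumber n else 0) ∧
    DerangementCddes.cddesEGF (-1 : ℚ) = DerangementCddes.secSeries := by
  refine ⟨fun R _ _ t => ?_, fun n _ => ?_, DerangementCddes.cddesEGF_neg_one⟩
  · have h := DerangementCddes.cddesEGF_mul t
    have hu := IsUnit.of_mul_eq_one _ h
    exact ⟨hu, (Ring.inverse_mul_cancel_left _ _ hu).symm.trans (by rw [h, mul_one])⟩
  · rw [DerangementCddes.eval_neg_one_cddesPoly]
    split_ifs with h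
    · rw [DerangementCddes.eulerNumber, map_add, DerangementCddes.coeff_tanSeries_of_even h,
        add_zero]
    · rw [DerangementCddes.coeff_secSeries_of_odd (Nat.not_even_iff_odd.1 h), mul_zero]
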